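/- Theorem 3 (cor:conctransport). Let $(\mathcal X,d)$ be a Polish metric space with its Borel $\sigma$-algebra. For Borel probability measures $\mu,\nu$ on $\mathcal X$ let $W_1(\mu,\nu)=\inf_{\pi}\int d(x,y)\,\mathrm d\pi(x,y)\in[0,\infty]$ be the 1-Wasserstein distance, the infimum running over all couplings $\pi$ of $\mu$ and $\nu$, and let $\mathcal P_1(\mathcal X)$ be the set of Borel probability measures with finite first moment. For $C>0$, a measure $\gamma\in\mathcal P_1(\mathcal X)$ is said to satisfy $T_1(C)$ if $W_1(\gamma,\nu)\le\sqrt{2C\,H(\nu\mid\gamma)}$ for every Borel probability measure $\nu\ll\gamma$, where $H(\nu\mid\gamma)\in[0,\infty]$ denotes the relative entropy. Let $P$ be a Markov kernel on $\mathcal X$ and $\kappa\in(0,1)$ such that the $n$-fold iterates satisfy $W_1(P^n(x,\cdot),P^n(y,\cdot))\le\kappa^n d(x,y)$ for all $n\ge1$ and $x,y\in\mathcal X$, and let $\mu$ be the invariant probability measure of $P$ (that is, $\mu P=\mu$). Let $X_0,X_1,X_2,\dots$ be a time-homogeneous Markov chain with transition kernel $P$ and initial law $\gamma_0$ (the law of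 $X_0$), defined on a probability space $(\Omega,\mathcal F,\mathbb P)$, and suppose that $\gamma_0$ and all the kernels $P(x,\cdot)$, $x\in\mathcal X$, satisfy $T_1(C)$. For $n\ge1$ let $\mu_n=\frac1n\sum_{i=1}^n\delta_{X_i}$ be the empirical measure. Then for all $n\ge1$ the random variable $W_1(\mu,\mu_n)$ is finite and integrable, and for all $t\ge0$ $$\mathbb P\bigl(W_1(\mu,\mu_n)\ge\mathbb E[W_1(\mu,\mu_n)]+t\bigr)\le\exp\Bigl(-\tfrac{1}{2C}\,n\,t^2(1-\kappa)^2\Bigr).$$ -/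

import Mathlib

open MeasureTheory ProbabilityTheory InformationTheory
open scoped ENNReal

noncomputable section

namespace MarkovConc

/-- The set `Π(μ, ν)` of couplings: measures on `X × X` with marginals `μ` and `ν`. (When `μ` is a
probability measure, every coupling is one.) -/
def couplings {X : Type*} [MeasurableSpace X] (μ ν : Measure X) : Set (Measure (X × X)) :=
  {π | π.fst = μ ∧ π.snd = ν}

/-- The `1`-Wasserstein distance, the infimum of the transport costs `∫ d(x, y) dπ(x, y)` over all
couplings `π`, with values in `[0, ∞]`. -/
def W₁ {X : Type*} [MetricSpace X] [MeasurableSpace X] (μ ν : Measure X) : ℝ≥0∞ :=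
  ⨅ π ∈ couplings μ ν, ∫⁻ z, edist z.1 z.2 ∂π

/-- `μ ∈ 𝒫₁(X)`: `μ` is a probability measure with finite first moment. -/
def MemP₁ {X : Type*} [MetricSpace X] [MeasurableSpace X] (μ : Measure X) : Prop :=
  IsProbabilityMeasure μ ∧ ∃ x₀ : X, ∫⁻ x, edist x₀ x ∂μ < ∞

/-- The transportation inequality `T₁(C)`: `μ ∈ 𝒫₁(X)`, and `W₁(μ, ν) ≤ √(2 C H(ν | μ))` for all
probability measures `ν ≪ μ`, where `H(ν | μ) = klDiv ν μ` is the relative entropy. -/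
def SatisfiesT₁ {X : Type*} [MetricSpace X] [MeasurableSpace X] (C : ℝ) (μ : Measure X) : Prop :=
  MemP₁ μ ∧ ∀ ν : Measure X, IsProbabilityMeasure ν → ν ≪ μ →
    W₁ μ ν ≤ (ENNReal.ofReal (2 * C) * klDiv ν μ) ^ (1 / 2 : ℝ)

/-- Exponential contraction with constants `D ≥ 1` and `κ ∈ (0, 1)`:
`W₁(Pⁿ(x, ·), Pⁿ(y, ·)) ≤ D κⁿ d(x, y)` for all `n ≥ 1` and all `x, y`. Here `P ^ n` is the
`n`-fold composition of the kernel `P`. -/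
structure IsExpContracting {X : Type*} [MetricSpace X] [MeasurableSpace X]
    (P : Kernel X X) (D κ : ℝ) : Prop where
  one_le : 1 ≤ D
  pos : 0 < κ
  lt_one : κ < 1
  contracting : ∀ n : ℕ, 1 ≤ n → ∀ x y : X,
    W₁ ((P ^ n) x) ((P ^ n) y) ≤ ENNReal.ofReal (D * κ ^ n) * edist x y

/-- `(Z₀, Z₁, …)` is a time-homogeneous Markov chain on the probability space `(Ω, Pr)` with initial
law `γ₀` and transition kernel `P`: `Z₀` has law `γ₀`, and for each `n` the conditional law of
`Zₙ₊₁` given `(Z₀, …, Zₙ)` is `P(Zₙ, ·)`, that is, the joint law of `((Z₀, …, Zₙ), Zₙ₊₁)` is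
`Law(Z₀, …, Zₙ)(dz) P(zₙ, dy)`. -/
structure IsMarkovChain {Ω X : Type*} [MeasurableSpace Ω] [MeasurableSpace X]
    (Pr : Measure Ω) (Z : ℕ → Ω → X) (γ₀ : Measure X) (P : Kernel X X) : Prop where
  measurable : ∀ n, Measurable (Z n)
  map_zero : Pr.map (Z 0) = γ₀
  map_succ : ∀ n : ℕ,
    Pr.map (fun ω ↦ ((fun i : Fin (n + 1) ↦ Z i ω), Z (n + 1) ω)) =
      (Pr.map (fun ω ↦ (fun i : Fin (n + 1) ↦ Z i ω))) ⊗ₘ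
        P.comap (fun z : Fin (n + 1) → X ↦ z (Fin.last n)) (measurable_pi_apply _)

/-- The empirical measure `μₙ = (1/n) ∑_{i=1}^n δ_{Zᵢ}`. -/
def empiricalMeasure {Ω X : Type*} [MeasurableSpace X] (Z : ℕ → Ω → X) (n : ℕ) (ω : Ω) :
    Measure X :=
  (n : ℝ≥0∞)⁻¹ • ∑ i ∈ Finset.Icc 1 n, Measure.dirac (Z i ω)

end MarkovConc

end

/-!
Let `F x = W₁(μ, (1/n) ∑ δ_{x i})`. It is finite because `μ` has a finite first moment
(`memP₁_of_invariant`), and it is `1/n`-Lipschitz in each of `x 1, …, x n`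
(`sepLipschitz_W₁_empiricalMeasure`). The theorem is a concentration inequality for such functions
of the path of the chain, proved by integrating out the variables from the last one to the first.

Write `G' x = ∫ G(x, u) P(x_j, du)`. If `G` is `ℓ i`-Lipschitz in `x i` for `i ≤ j` and
`c`-Lipschitz in its last variable `u`, then `G'` is `ℓ i`-Lipschitz for `i < j`, and, because `P`
contracts `W₁` by `κ`, it is `(ℓ j + κ c)`-Lipschitz in `x j` (`SepLipschitz.integral_snoc`).
Each such step costs a factor `exp (C c² / 2)` in the Laplace transform
(`SatisfiesT₁.lintegral_exp_le`, the Bobkov–Götze bound), so that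
`𝔼 exp G ≤ exp (𝔼 G + (C / 2) ∑ (L i)²)` with the resulting constants `L i`
(`IsMarkovChain.lintegral_exp_le`). For `G = lam F` all of these are at most
`s = lam / (n (1 - κ))`, and the sum of the `n + 1` squares, the one of the initial variable
included, is at most `n s²` (`IsMarkovChain.lintegral_exp_le_of_forall_eq`). Markov's inequality,
with the best choice of `lam`, gives the claim.
-/

namespace MarkovConc

open Filter Topology
open scoped NNReal

/-! ### Lipschitz functions and the Wasserstein distance -/

section Wasserstein

variable {X : Type*} [MetricSpace X] [MeasurableSpace X]

lemma W₁_le_of_mem_couplings {μ ν : Measure X} {π : Measure (X × X)} (hπ : π ∈ couplings μ ν) :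
    W₁ μ ν ≤ ∫⁻ z, edist z.1 z.2 ∂π :=
  iInf₂_le π hπ

lemma MemP₁.integrable_of_lipschitz [BorelSpace X] [SecondCountableTopology X]
    {μ : Measure X} (hμ : MemP₁ μ) {f : X → ℝ} {L : ℝ≥0} (hf : LipschitzWith L f) :
    Integrable f μ := by
  obtain ⟨hμ, x₀, hx₀⟩ := hμ
  have hd : Integrable (fun x ↦ dist x₀ x) μ := by
    refine ⟨(by fun_prop : Continuous fun x ↦ dist x₀ x).aestronglyMeasurable, ?_⟩
    rw [hasFiniteIntegral_iff_enorm]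
    convert hx₀ using 3 with x
    rw [edist_dist, Real.enorm_of_nonneg dist_nonneg]
  refine ((hd.const_mul L).add (integrable_const |f x₀|)).mono'
    hf.continuous.aestronglyMeasurable (ae_of_all _ fun x ↦ ?_)
  have h := hf.dist_le_mul x x₀
  rw [Real.dist_eq, dist_comm] at h
  have := abs_sub_abs_le_abs_sub (f x) (f x₀)
  simp only [Real.norm_eq_abs, Pi.add_apply]
  linarith

lemma MemP₁.lintegral_edist_lt_top [BorelSpace X] {μ : Measure X} (hμ : MemP₁ μ) (x : X) :
    ∫⁻ y, edist x y ∂μ < ∞ := by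
  obtain ⟨hμ, x₀, hx₀⟩ := hμ
  calc ∫⁻ y, edist x y ∂μ ≤ ∫⁻ y, (edist x x₀ + edist x₀ y) ∂μ :=
        lintegral_mono fun y ↦ edist_triangle x x₀ y
    _ = edist x x₀ + ∫⁻ y, edist x₀ y ∂μ := by
        rw [lintegral_add_left measurable_const]; simp
    _ < ∞ := ENNReal.add_lt_top.2 ⟨edist_lt_top _ _, hx₀⟩

/-- The easy half of Kantorovich–Rubinstein duality. -/
lemma integral_sub_integral_le_of_W₁_le [BorelSpace X] [SecondCountableTopology X]
    {μ ν : Measure X} {f : X → ℝ} {L : ℝ≥0} (hf : LipschitzWith L f) (hfμ : Integrable f μ)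
    (hfν : Integrable f ν) {w : ℝ} (hw : 0 ≤ w) (h : W₁ μ ν ≤ ENNReal.ofReal w) :
    ∫ x, f x ∂ν - ∫ x, f x ∂μ ≤ L * w := by
  have key : ∀ ε > 0, ∫ x, f x ∂ν - ∫ x, f x ∂μ ≤ L * (w + ε) := by
    intro ε hε
    have hlt : W₁ μ ν < ENNReal.ofReal (w + ε) :=
      h.trans_lt ((ENNReal.ofReal_lt_ofReal_iff (by linarith)).2 (by linarith))
    simp only [W₁, iInf_lt_iff] at hlt
    obtain ⟨π, ⟨rfl, rfl⟩, hπ⟩ := hlt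
    have hdist : ∀ z : X × X, edist z.1 z.2 = ENNReal.ofReal (dist z.1 z.2) :=
      fun z ↦ edist_dist _ _
    simp_rw [hdist] at hπ
    have hdi : Integrable (fun z : X × X ↦ dist z.1 z.2) π :=
      (lintegral_ofReal_ne_top_iff_integrable
        (by fun_prop : Continuous fun z : X × X ↦ dist z.1 z.2).aestronglyMeasurable
        (ae_of_all _ fun _ ↦ dist_nonneg)).1 hπ.ne_top
    have hd : ∫ z, dist z.1 z.2 ∂π ≤ w + ε := by
      rw [← ofReal_integral_eq_lintegral_ofReal hdi (ae_of_all _ fun _ ↦ dist_nonneg)] at hπ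
      exact (ENNReal.ofReal_le_ofReal_iff (by linarith)).1 hπ.le
    have hm := hf.continuous.measurable
    have h1 : Integrable (fun z : X × X ↦ f z.1) π := hfμ.comp_measurable measurable_fst
    have h2 : Integrable (fun z : X × X ↦ f z.2) π := hfν.comp_measurable measurable_snd
    rw [Measure.fst, Measure.snd,
      integral_map measurable_fst.aemeasurable hm.aestronglyMeasurable,
      integral_map measurable_snd.aemeasurable hm.aestronglyMeasurable, ← integral_sub h2 h1]
    calc ∫ z, (f z.2 - f z.1) ∂π ≤ ∫ z, L * dist z.1 z.2 ∂π := by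
          refine integral_mono (h2.sub h1) (hdi.const_mul _) fun z ↦ ?_
          rw [dist_comm]
          exact (le_abs_self _).trans (hf.dist_le_mul z.2 z.1)
      _ = L * ∫ z, dist z.1 z.2 ∂π := integral_const_mul _ _
      _ ≤ L * (w + ε) := by gcongr
  have hlim : Tendsto (fun ε : ℝ ↦ L * (w + ε)) (𝓝[>] 0) (𝓝 (L * (w + 0))) :=
    (Continuous.tendsto (by fun_prop) 0).mono_left nhdsWithin_le_nhds
  rw [add_zero] at hlim
  exact ge_of_tendsto hlim (eventually_mem_nhdsWithin.mono fun ε hε ↦ key ε hε)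

/-! ### Exponential moments from the transportation inequality -/

/-- For bounded `f`, the inequality `T₁(C)` is applied to the tilted measure `ν ∝ e ^ f γ`, whose
relative entropy is `∫ f dν - log ∫ e ^ f dγ`. -/
lemma SatisfiesT₁.lintegral_exp_le_of_bounded [BorelSpace X] [SecondCountableTopology X]
    {C : ℝ} (hC : 0 ≤ C) {γ : Measure X} (h : SatisfiesT₁ C γ) {f : X → ℝ} {L : ℝ≥0}
    (hf : LipschitzWith L f) {B : ℝ} (hB : ∀ x, |f x| ≤ B) :
    ∫⁻ x, ENNReal.ofReal (Real.exp (f x)) ∂γ ≤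
      ENNReal.ofReal (Real.exp (∫ x, f x ∂γ + C / 2 * L ^ 2)) := by
  have := h.1.1
  have hm := hf.continuous.measurable
  have hexp : Integrable (fun x ↦ Real.exp (f x)) γ :=
    .of_bound (C := Real.exp B) hm.exp.aestronglyMeasurable (ae_of_all _ fun x ↦ by
      rw [Real.norm_eq_abs, Real.abs_exp]
      exact Real.exp_le_exp.2 ((le_abs_self _).trans (hB x)))
  set ν := γ.tilted f
  have hν : IsProbabilityMeasure ν := isProbabilityMeasure_tilted hexp
  have hac : ν ≪ γ := tilted_absolutelyContinuous γ f
  have hfγ : Integrable f γ :=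
    .of_bound (C := B) hm.aestronglyMeasurable (ae_of_all _ hB)
  have hfν : Integrable f ν :=
    .of_bound (C := B) hm.aestronglyMeasurable (ae_of_all _ hB)
  have hllr : llr ν γ =ᵐ[ν] fun x ↦ f x - Real.log (∫ x, Real.exp (f x) ∂γ) :=
    hac.ae_le (log_rnDeriv_tilted_left_self hexp)
  have hllr_int : Integrable (llr ν γ) ν :=
    (integrable_congr hllr).2 (hfν.sub (integrable_const _))
  have hH : (klDiv ν γ).toReal = ∫ x, f x ∂ν - Real.log (∫ x, Real.exp (f x) ∂γ) := by
    rw [toReal_klDiv_of_measure_eq hac (by simp), integral_congr_ae hllr,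
      integral_sub hfν (integrable_const _)]
    simp
  set H := (klDiv ν γ).toReal
  have hH0 : 0 ≤ H := ENNReal.toReal_nonneg
  have hW : W₁ γ ν ≤ ENNReal.ofReal (Real.sqrt (2 * C * H)) := by
    refine (h.2 ν hν hac).trans_eq ?_
    rw [← ENNReal.ofReal_toReal (klDiv_ne_top hac hllr_int),
      ← ENNReal.ofReal_mul (by positivity),
      ENNReal.ofReal_rpow_of_nonneg (by positivity) (by norm_num), Real.sqrt_eq_rpow]
  have hdual := integral_sub_integral_le_of_W₁_le hf hfγ hfν (Real.sqrt_nonneg _) hW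
  have hs : Real.sqrt (2 * C * H) = Real.sqrt C * Real.sqrt (2 * H) := by
    rw [← Real.sqrt_mul hC]; congr 1; ring
  -- `L √(2CH) ≤ C L² / 2 + H` by the inequality of arithmetic and geometric means
  have hamgm : L * Real.sqrt (2 * C * H) ≤ C / 2 * L ^ 2 + H := by
    rw [hs]
    nlinarith [sq_nonneg (L * Real.sqrt C - Real.sqrt (2 * H)), Real.sq_sqrt hC,
      Real.sq_sqrt (by positivity : 0 ≤ 2 * H)]
  rw [← ofReal_integral_eq_lintegral_ofReal hexp (ae_of_all _ fun _ ↦ (Real.exp_pos _).le)]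
  refine ENNReal.ofReal_le_ofReal ?_
  rw [← Real.log_le_iff_le_exp (integral_exp_pos hexp)]
  linarith

/-- The Bobkov–Götze bound on the Laplace transform of Lipschitz functions. An unbounded `f` is
truncated at `±N`, and Fatou's lemma is applied as `N → ∞`. -/
lemma SatisfiesT₁.lintegral_exp_le [BorelSpace X] [SecondCountableTopology X]
    {C : ℝ} (hC : 0 ≤ C) {γ : Measure X} (h : SatisfiesT₁ C γ) {f : X → ℝ} {L : ℝ≥0}
    (hf : LipschitzWith L f) :
    ∫⁻ x, ENNReal.ofReal (Real.exp (f x)) ∂γ ≤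
      ENNReal.ofReal (Real.exp (∫ x, f x ∂γ + C / 2 * L ^ 2)) := by
  have hfγ := h.1.integrable_of_lipschitz hf
  let g : ℕ → X → ℝ := fun N x ↦ max (-(N : ℝ)) (min N (f x))
  have hgL : ∀ N, LipschitzWith L (g N) := fun N ↦ (hf.const_min _).const_max _
  have hgB : ∀ N x, |g N x| ≤ N := fun N x ↦ by
    refine abs_le.2 ⟨le_max_left _ _, max_le ?_ (min_le_left _ _)⟩
    linarith [N.cast_nonneg (α := ℝ)]
  have hgf : ∀ N x, |g N x| ≤ |f x| := fun N x ↦ by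
    have hN := N.cast_nonneg (α := ℝ)
    refine abs_le.2 ⟨?_, max_le (by linarith [abs_nonneg (f x)])
      ((min_le_right _ _).trans (le_abs_self _))⟩
    rcases le_total (N : ℝ) (f x) with hx | hx
    · exact le_max_of_le_right (by rw [min_eq_left hx]; linarith [abs_nonneg (f x)])
    · exact le_max_of_le_right (by rw [min_eq_right hx]; exact neg_abs_le _)
  have hlim : ∀ x, Tendsto (fun N ↦ g N x) atTop (𝓝 (f x)) := fun x ↦ by
    refine tendsto_const_nhds.congr' ?_
    filter_upwards [eventually_ge_atTop ⌈|f x|⌉₊] with N hN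
    have := abs_le.1 (Nat.ceil_le.1 hN)
    simp [g, min_eq_right this.2, max_eq_right this.1]
  have hint : Tendsto (fun N ↦ ∫ x, g N x ∂γ) atTop (𝓝 (∫ x, f x ∂γ)) :=
    tendsto_integral_of_dominated_convergence (fun x ↦ |f x|)
      (fun N ↦ (hgL N).continuous.aestronglyMeasurable) hfγ.abs
      (fun N ↦ ae_of_all _ (hgf N)) (ae_of_all _ hlim)
  have hcont : Continuous fun s : ℝ ↦ ENNReal.ofReal (Real.exp s) :=
    ENNReal.continuous_ofReal.comp Real.continuous_exp
  calc ∫⁻ x, ENNReal.ofReal (Real.exp (f x)) ∂γ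
      = ∫⁻ x, liminf (fun N ↦ ENNReal.ofReal (Real.exp (g N x))) atTop ∂γ :=
        lintegral_congr fun x ↦ ((hcont.tendsto _).comp (hlim x)).liminf_eq.symm
    _ ≤ liminf (fun N ↦ ∫⁻ x, ENNReal.ofReal (Real.exp (g N x)) ∂γ) atTop :=
        lintegral_liminf_le fun N ↦ (hcont.comp (hgL N).continuous).measurable
    _ ≤ liminf (fun N ↦ ENNReal.ofReal (Real.exp (∫ x, g N x ∂γ + C / 2 * L ^ 2))) atTop :=
        liminf_le_liminf
          (Eventually.of_forall fun N ↦ h.lintegral_exp_le_of_bounded hC (hgL N) (hgB N))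
    _ = ENNReal.ofReal (Real.exp (∫ x, f x ∂γ + C / 2 * L ^ 2)) :=
        ((hcont.tendsto _).comp (hint.add_const _)).liminf_eq

end Wasserstein

/-! ### Empirical measures -/

section Empirical

lemma lintegral_empiricalMeasure {X Ω : Type*} [MeasurableSpace X] (Z : ℕ → Ω → X) (n : ℕ)
    (ω : Ω) {f : X → ℝ≥0∞} (hf : Measurable f) :
    ∫⁻ x, f x ∂empiricalMeasure Z n ω = (n : ℝ≥0∞)⁻¹ * ∑ i ∈ Finset.Icc 1 n, f (Z i ω) := by
  simp [empiricalMeasure, lintegral_finsetSum_measure, lintegral_dirac' _ hf]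

lemma isProbabilityMeasure_empiricalMeasure {X Ω : Type*} [MeasurableSpace X] (Z : ℕ → Ω → X)
    {n : ℕ} (hn : 1 ≤ n) (ω : Ω) : IsProbabilityMeasure (empiricalMeasure Z n ω) := by
  constructor
  rw [← lintegral_one, lintegral_empiricalMeasure Z n ω measurable_const]
  simp [ENNReal.inv_mul_cancel (Nat.cast_ne_zero.2 (by lia : n ≠ 0))]

variable {X : Type*} [MetricSpace X] [MeasurableSpace X]

lemma W₁_empiricalMeasure_ne_top [BorelSpace X] [SecondCountableTopology X] {μ : Measure X}
    (hμ : MemP₁ μ) {Ω : Type*} (Z : ℕ → Ω → X) {n : ℕ} (hn : 1 ≤ n) (ω : Ω) :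
    W₁ μ (empiricalMeasure Z n ω) ≠ ∞ := by
  have := hμ.1
  have := isProbabilityMeasure_empiricalMeasure Z hn ω
  have hmem : μ.prod (empiricalMeasure Z n ω) ∈ couplings μ (empiricalMeasure Z n ω) :=
    ⟨by simp, by simp⟩
  refine ((W₁_le_of_mem_couplings hmem).trans_lt ?_).ne
  rw [lintegral_prod_symm _ (by fun_prop),
    lintegral_empiricalMeasure Z n ω (by fun_prop : Measurable fun z : X × X ↦
      edist z.1 z.2).lintegral_prod_left']
  refine ENNReal.mul_lt_top (by simp; lia) (ENNReal.sum_lt_top.2 fun i _ ↦ ?_)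
  simp_rw [edist_comm _ (Z i ω)]
  exact hμ.lintegral_edist_lt_top _

/-- Moving the atoms of an empirical measure changes its distance to `μ` by at most the average
displacement: a coupling with the first empirical measure is disintegrated over its atoms, and each
conditional law is then coupled with the corresponding new atom. -/
lemma W₁_empiricalMeasure_le_add [PolishSpace X] [BorelSpace X] {μ : Measure X}
    [IsProbabilityMeasure μ] {Ω : Type*} (Z : ℕ → Ω → X) {n : ℕ} (ω ω' : Ω) :
    W₁ μ (empiricalMeasure Z n ω') ≤ W₁ μ (empiricalMeasure Z n ω) +
      (n : ℝ≥0∞)⁻¹ * ∑ i ∈ Finset.Icc 1 n, edist (Z i ω) (Z i ω') := by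
  have : Nonempty X := μ.nonempty_of_neZero
  conv_rhs => rw [W₁, ENNReal.iInf₂_add]
  refine le_iInf₂ fun π hπ ↦ ?_
  obtain ⟨hπ1, hπ2⟩ := hπ
  have : IsFiniteMeasure π := ⟨by
    rw [← Measure.fst_univ, hπ1]; exact measure_lt_top _ _⟩
  let ρ := π.map Prod.swap
  have hρ1 : ρ.fst = empiricalMeasure Z n ω := by rw [Measure.fst_map_swap, hπ2]
  have hρ2 : ρ.snd = μ := by rw [Measure.snd_map_swap, hπ1]
  let K := ρ.condKernel
  have hdis : ρ.fst ⊗ₘ K = ρ := ρ.disintegrate K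
  -- `K x` is the law of the first coordinate under `π`, given that the second one is `x`
  let π' := (n : ℝ≥0∞)⁻¹ • ∑ i ∈ Finset.Icc 1 n, (K (Z i ω)).prod (Measure.dirac (Z i ω'))
  have hlint : ∀ g : X × X → ℝ≥0∞, Measurable g → ∫⁻ z, g z ∂π' =
      (n : ℝ≥0∞)⁻¹ * ∑ i ∈ Finset.Icc 1 n, ∫⁻ x, g (x, Z i ω') ∂K (Z i ω) := by
    intro g hg
    simp only [π', lintegral_smul_measure, lintegral_finsetSum_measure, smul_eq_mul]
    congr 1
    refine Finset.sum_congr rfl fun i _ ↦ ?_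
    rw [lintegral_prod _ hg.aemeasurable]
    refine lintegral_congr fun x ↦ ?_
    rw [lintegral_dirac' _ (by fun_prop)]
  have hρint : ∀ g : X × X → ℝ≥0∞, Measurable g → ∫⁻ z, g z ∂ρ =
      (n : ℝ≥0∞)⁻¹ * ∑ i ∈ Finset.Icc 1 n, ∫⁻ x, g (Z i ω, x) ∂K (Z i ω) := by
    intro g hg
    rw [← hdis, Measure.lintegral_compProd hg, hρ1,
      lintegral_empiricalMeasure Z n ω hg.lintegral_kernel_prod_right']
  have hmem : π' ∈ couplings μ (empiricalMeasure Z n ω') := by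
    constructor
    · ext s hs
      rw [Measure.fst_apply hs, ← lintegral_indicator_one (measurable_fst hs),
        hlint _ (measurable_one.indicator (measurable_fst hs)), ← hρ2, Measure.snd_apply hs,
        ← lintegral_indicator_one (measurable_snd hs),
        hρint _ (measurable_one.indicator (measurable_snd hs))]
      rfl
    · ext s hs
      rw [Measure.snd_apply hs, ← lintegral_indicator_one (measurable_snd hs),
        hlint _ (measurable_one.indicator (measurable_snd hs)),
        ← lintegral_indicator_one hs, lintegral_empiricalMeasure _ _ _
          (measurable_one.indicator hs)]
      congr 1
      refine Finset.sum_congr rfl fun i _ ↦ ?_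
      have : ∀ x, (Prod.snd ⁻¹' s : Set (X × X)).indicator (1 : X × X → ℝ≥0∞) (x, Z i ω') =
        s.indicator 1 (Z i ω') := fun x ↦ rfl
      simp [this]
  refine (W₁_le_of_mem_couplings hmem).trans ?_
  have hcost : ∫⁻ z, edist z.1 z.2 ∂π =
      (n : ℝ≥0∞)⁻¹ * ∑ i ∈ Finset.Icc 1 n, ∫⁻ x, edist x (Z i ω) ∂K (Z i ω) := by
    rw [← hρint (fun z ↦ edist z.2 z.1) (by fun_prop), lintegral_map (by fun_prop) measurable_swap]
    rfl
  rw [hlint _ (by fun_prop), hcost, ← mul_add, ← Finset.sum_add_distrib]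
  gcongr with i
  calc ∫⁻ x, edist x (Z i ω') ∂K (Z i ω)
      ≤ ∫⁻ x, (edist x (Z i ω) + edist (Z i ω) (Z i ω')) ∂K (Z i ω) :=
        lintegral_mono fun x ↦ edist_triangle _ _ _
    _ = ∫⁻ x, edist x (Z i ω) ∂K (Z i ω) + edist (Z i ω) (Z i ω') := by
        rw [lintegral_add_right _ measurable_const]; simp

end Empirical

/-! ### Moments of contracting kernels -/

section Moments

variable {X : Type*} [MetricSpace X] [MeasurableSpace X]

lemma lintegral_edist_kernel_le [BorelSpace X] [SecondCountableTopology X] {P : Kernel X X}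
    {k : ℝ≥0} (hk : ∀ x y, W₁ (P x) (P y) ≤ k * edist x y) (x₀ x : X) :
    ∫⁻ y, edist x₀ y ∂P x ≤ ∫⁻ y, edist x₀ y ∂P x₀ + k * edist x₀ x := by
  refine le_trans ?_ (add_le_add_right (hk x₀ x) _)
  rw [W₁, ENNReal.add_iInf₂]
  refine le_iInf₂ fun π hπ ↦ ?_
  obtain ⟨h1, h2⟩ := hπ
  rw [← h1, ← h2, Measure.fst, Measure.snd, lintegral_map (by fun_prop) measurable_fst,
    lintegral_map (by fun_prop) measurable_snd, ← lintegral_add_left (by fun_prop)]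
  exact lintegral_mono fun z ↦ edist_triangle _ _ _

/-- An invariant probability measure of a contracting kernel has a finite first moment. With
`V = d(x₀, ·)` and `PV ≤ a + k V`, invariance and concavity of the truncation give
`∫ min V R dμ ≤ ∫ min (bₙ + k ^ n V) R dμ` with `bₙ = a (1 + k + ⋯ + k ^ (n - 1))`, for all `n`.
Let `n → ∞`, then `R → ∞`. -/
lemma memP₁_of_invariant [BorelSpace X] [SecondCountableTopology X] {P : Kernel X X}
    [IsMarkovKernel P] {k : ℝ≥0} (hk1 : k < 1)
    (hk : ∀ x y, W₁ (P x) (P y) ≤ k * edist x y) (hP : ∀ x, MemP₁ (P x))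
    {μ : Measure X} [IsProbabilityMeasure μ] (hμ : Kernel.Invariant P μ) : MemP₁ μ := by
  obtain ⟨x₀⟩ : Nonempty X := μ.nonempty_of_neZero
  set a := ∫⁻ y, edist x₀ y ∂P x₀
  have ha : a < ∞ := (hP x₀).lintegral_edist_lt_top x₀
  have hk1' : (k : ℝ≥0∞) < 1 := by exact_mod_cast hk1
  have hstep : ∀ R : ℝ≥0∞, ∀ n : ℕ, ∫⁻ x, min (edist x₀ x) R ∂μ ≤
      ∫⁻ x, min ((∑ j ∈ Finset.range n, (k : ℝ≥0∞) ^ j) * a +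
        (k : ℝ≥0∞) ^ n * edist x₀ x) R ∂μ := by
    intro R n
    induction n with
    | zero => simp
    | succ n ih =>
      refine ih.trans ?_
      set b := (∑ j ∈ Finset.range n, (k : ℝ≥0∞) ^ j) * a
      conv_lhs => rw [← hμ.def]
      rw [Measure.lintegral_bind P.aemeasurable (by fun_prop)]
      refine lintegral_mono fun x ↦ le_min ?_ ?_
      · calc ∫⁻ y, min (b + (k : ℝ≥0∞) ^ n * edist x₀ y) R ∂P x
            ≤ ∫⁻ y, (b + (k : ℝ≥0∞) ^ n * edist x₀ y) ∂P x :=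
              lintegral_mono fun y ↦ min_le_left _ _
          _ = b + (k : ℝ≥0∞) ^ n * ∫⁻ y, edist x₀ y ∂P x := by
              rw [lintegral_add_left measurable_const, lintegral_const, measure_univ, mul_one,
                lintegral_const_mul _ (by fun_prop)]
          _ ≤ b + (k : ℝ≥0∞) ^ n * (a + k * edist x₀ x) := by
              gcongr; exact lintegral_edist_kernel_le hk x₀ x
          _ = (∑ j ∈ Finset.range (n + 1), (k : ℝ≥0∞) ^ j) * a +
                (k : ℝ≥0∞) ^ (n + 1) * edist x₀ x := by
              rw [Finset.sum_range_succ]; ring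
      · exact (lintegral_mono fun y ↦ min_le_right _ _).trans (by simp)
  set b := (1 - (k : ℝ≥0∞))⁻¹ * a
  have hb : b < ∞ := ENNReal.mul_lt_top (by simpa using hk1) ha
  have htrunc : ∀ N : ℕ, ∫⁻ x, min (edist x₀ x) N ∂μ ≤ b := by
    intro N
    have hlim : Tendsto (fun n : ℕ ↦ ∫⁻ x, min (b + (k : ℝ≥0∞) ^ n * edist x₀ x) N ∂μ) atTop
        (𝓝 (∫⁻ _, min (b + 0) N ∂μ)) := by
      refine tendsto_lintegral_of_dominated_convergence (fun _ ↦ (N : ℝ≥0∞))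
        (fun n ↦ by fun_prop) (fun n ↦ ae_of_all _ fun x ↦ min_le_right _ _) (by simp)
        (ae_of_all _ fun x ↦ ?_)
      have h0 := ENNReal.Tendsto.mul_const (b := edist x₀ x)
        (ENNReal.tendsto_pow_atTop_nhds_zero_of_lt_one hk1') (Or.inr (edist_ne_top _ _))
      rw [zero_mul] at h0
      exact (tendsto_const_nhds.add h0).min tendsto_const_nhds
    refine (ge_of_tendsto' hlim fun n ↦ (hstep N n).trans (lintegral_mono fun x ↦ ?_)).trans ?_
    · refine min_le_min_right _ (add_le_add_left (mul_le_mul_left ?_ _) _)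
      rw [← ENNReal.tsum_geometric]
      exact ENNReal.sum_le_tsum _
    · simp
  refine ⟨inferInstance, x₀, lt_of_le_of_lt ?_ hb⟩
  refine le_of_tendsto' (lintegral_tendsto_of_tendsto_of_monotone
    (f := fun (N : ℕ) x ↦ min (edist x₀ x) N) (fun N : ℕ ↦ by fun_prop)
    (ae_of_all _ fun x N M hNM ↦ min_le_min_left _ (by exact_mod_cast hNM))
    (ae_of_all _ fun x ↦ ?_)) htrunc
  have h0 := (tendsto_const_nhds (x := edist x₀ x)).min ENNReal.tendsto_nat_nhds_top
  simpa using h0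

end Moments

/-! ### Separately Lipschitz functions of the path of a Markov chain -/

section Path

variable {X : Type*} [MetricSpace X]

/-- `G x - G y ≤ ∑ i < n, ℓ i * d(x i, y i) + c * d(x n, y n)` for all `x` and `y`: the
function `G` of `n + 1` variables is Lipschitz with a separate constant for each variable, the last one being `c`. -/
def SepLipschitz {n : ℕ} (ℓ : ℕ → ℝ≥0) (c : ℝ≥0) (G : (Fin (n + 1) → X) → ℝ) : Prop :=
  ∀ x y : Fin (n + 1) → X, G x - G y ≤
    ∑ i : Fin n, ℓ i * dist (x i.castSucc) (y i.castSucc)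
      + c * dist (x (Fin.last n)) (y (Fin.last n))

lemma SepLipschitz.abs_sub_le {n : ℕ} {ℓ : ℕ → ℝ≥0} {c : ℝ≥0} {G : (Fin (n + 1) → X) → ℝ}
    (hG : SepLipschitz ℓ c G) (x y : Fin (n + 1) → X) :
    |G x - G y| ≤ ∑ i : Fin n, ℓ i * dist (x i.castSucc) (y i.castSucc)
      + c * dist (x (Fin.last n)) (y (Fin.last n)) := by
  refine abs_le.2 ⟨?_, hG x y⟩
  have := hG y x
  simp_rw [dist_comm (y _)] at this
  linarith

lemma SepLipschitz.lipschitzWith {n : ℕ} {ℓ : ℕ → ℝ≥0} {c : ℝ≥0} {G : (Fin (n + 1) → X) → ℝ}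
    (hG : SepLipschitz ℓ c G) : LipschitzWith (∑ i : Fin n, ℓ i + c) G := by
  refine LipschitzWith.of_dist_le_mul fun x y ↦ ?_
  rw [Real.dist_eq]
  refine (hG.abs_sub_le x y).trans ?_
  push_cast
  rw [add_mul, Finset.sum_mul]
  gcongr with i <;> exact dist_le_pi_dist _ _ _

lemma SepLipschitz.comp_snoc {n : ℕ} {ℓ : ℕ → ℝ≥0} {c : ℝ≥0} {G : (Fin (n + 2) → X) → ℝ}
    (hG : SepLipschitz ℓ c G) (x : Fin (n + 1) → X) :
    LipschitzWith c fun u : X ↦ G (Fin.snoc x u : Fin (n + 2) → X) := by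
  refine LipschitzWith.of_dist_le_mul fun u v ↦ ?_
  simpa [Real.dist_eq] using hG.abs_sub_le (Fin.snoc x u : Fin (n + 2) → X)
    (Fin.snoc x v : Fin (n + 2) → X)

/-- Averaging over the last variable: the new last constant collects the direct dependence on the
last remaining variable and the dependence through the kernel, which contracts by `k`. -/
lemma SepLipschitz.integral_snoc [MeasurableSpace X] [BorelSpace X] [SecondCountableTopology X]
    {P : Kernel X X} {k : ℝ≥0} (hk : ∀ x y, W₁ (P x) (P y) ≤ k * edist x y)
    (hP : ∀ x, MemP₁ (P x)) {n : ℕ} {ℓ : ℕ → ℝ≥0} {c c' : ℝ≥0} (hc : ℓ n + k * c ≤ c')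
    {G : (Fin (n + 2) → X) → ℝ}
    (hG : SepLipschitz ℓ c G) :
    SepLipschitz ℓ c' fun x : Fin (n + 1) → X ↦
      ∫ u, G (Fin.snoc x u : Fin (n + 2) → X) ∂P (x (Fin.last n)) := by
  intro x y
  have := (hP (x (Fin.last n))).1
  have hint : ∀ z w, Integrable (fun u ↦ G (Fin.snoc z u : Fin (n + 2) → X)) (P w) :=
    fun z w ↦ (hP w).integrable_of_lipschitz (hG.comp_snoc z)
  have h1 : ∫ u, G (Fin.snoc x u : Fin (n + 2) → X) ∂P (x (Fin.last n)) -
      ∫ u, G (Fin.snoc y u : Fin (n + 2) → X) ∂P (x (Fin.last n)) ≤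
      ∑ i : Fin (n + 1), ℓ i * dist (x i) (y i) := by
    rw [← integral_sub (hint _ _) (hint _ _)]
    refine (integral_mono ((hint _ _).sub (hint _ _)) (integrable_const _) fun u ↦ ?_).trans_eq
      (by simp : ∫ _, ∑ i : Fin (n + 1), ℓ i * dist (x i) (y i) ∂P (x (Fin.last n)) = _)
    simpa using hG (Fin.snoc x u : Fin (n + 2) → X) (Fin.snoc y u : Fin (n + 2) → X)
  have h2 := integral_sub_integral_le_of_W₁_le (hG.comp_snoc y) (hint y (y (Fin.last n)))
    (hint y (x (Fin.last n))) (w := k * dist (x (Fin.last n)) (y (Fin.last n))) (by positivity) (by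
      rw [ENNReal.ofReal_mul (by positivity), ENNReal.ofReal_coe_nnreal, ← edist_dist, edist_comm]
      exact hk _ _)
  rw [Fin.sum_univ_castSucc] at h1
  simp only [Fin.val_castSucc, Fin.val_last] at h1
  have hc' : (ℓ n : ℝ) + k * c ≤ c' := by exact_mod_cast hc
  have h3 := mul_le_mul_of_nonneg_right hc'
    (dist_nonneg (x := x (Fin.last n)) (y := y (Fin.last n)))
  beta_reduce
  linarith

section Chain

variable {Ω X : Type*} [MeasurableSpace Ω] [MeasurableSpace X] {Pr : Measure Ω}
  [IsProbabilityMeasure Pr] {Z : ℕ → Ω → X} {γ₀ : Measure X} {P : Kernel X X} [IsMarkovKernel P]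

lemma IsMarkovChain.lintegral_succ
    (hZ : IsMarkovChain Pr Z γ₀ P) (n : ℕ)
    {g : (Fin (n + 1) → X) × X → ℝ≥0∞} (hg : Measurable g) :
    ∫⁻ ω, g (fun i : Fin (n + 1) ↦ Z i ω, Z (n + 1) ω) ∂Pr =
      ∫⁻ ω, ∫⁻ u, g (fun i : Fin (n + 1) ↦ Z i ω, u) ∂P (Z n ω) ∂Pr := by
  have hm : Measurable fun ω ↦ (fun i : Fin (n + 1) ↦ Z i ω) :=
    measurable_pi_lambda _ fun i ↦ hZ.measurable i
  have := (Measure.isProbabilityMeasure_map hm.aemeasurable (μ := Pr))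
  rw [← lintegral_map (μ := Pr) hg (hm.prodMk (hZ.measurable (n + 1))), hZ.map_succ n,
    Measure.lintegral_compProd hg, lintegral_map hg.lintegral_kernel_prod_right' hm]
  simp

lemma IsMarkovChain.integral_succ
    (hZ : IsMarkovChain Pr Z γ₀ P) (n : ℕ)
    {g : (Fin (n + 1) → X) × X → ℝ} (hg : Measurable g)
    (hgi : Integrable (fun ω ↦ g (fun i : Fin (n + 1) ↦ Z i ω, Z (n + 1) ω)) Pr) :
    ∫ ω, g (fun i : Fin (n + 1) ↦ Z i ω, Z (n + 1) ω) ∂Pr =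
      ∫ ω, ∫ u, g (fun i : Fin (n + 1) ↦ Z i ω, u) ∂P (Z n ω) ∂Pr := by
  have hm : Measurable fun ω ↦ (fun i : Fin (n + 1) ↦ Z i ω) :=
    measurable_pi_lambda _ fun i ↦ hZ.measurable i
  have := (Measure.isProbabilityMeasure_map hm.aemeasurable (μ := Pr))
  have hm2 := hm.prodMk (hZ.measurable (n + 1))
  have hgi' := (integrable_map_measure hg.aestronglyMeasurable hm2.aemeasurable).2 hgi
  rw [← integral_map (μ := Pr) hm2.aemeasurable hg.aestronglyMeasurable, hZ.map_succ n]
  rw [hZ.map_succ n] at hgi'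
  rw [Measure.integral_compProd hgi', integral_map hm.aemeasurable
    hg.stronglyMeasurable.integral_kernel_prod_right'.aestronglyMeasurable]
  simp

variable [MetricSpace X]

lemma IsMarkovChain.lintegral_edist_lt_top [BorelSpace X] [SecondCountableTopology X]
    {k : ℝ≥0}
    (hk : ∀ x y, W₁ (P x) (P y) ≤ k * edist x y) (hP : ∀ x, MemP₁ (P x)) (hγ₀ : MemP₁ γ₀)
    (hZ : IsMarkovChain Pr Z γ₀ P) (x₀ : X) (n : ℕ) :
    ∫⁻ ω, edist x₀ (Z n ω) ∂Pr < ∞ := by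
  induction n with
  | zero =>
    rw [← lintegral_map (f := fun x ↦ edist x₀ x) (by fun_prop) (hZ.measurable 0), hZ.map_zero]
    exact hγ₀.lintegral_edist_lt_top x₀
  | succ n ih =>
    rw [hZ.lintegral_succ n (g := fun z ↦ edist x₀ z.2) (by fun_prop)]
    calc ∫⁻ ω, ∫⁻ u, edist x₀ u ∂P (Z n ω) ∂Pr
        ≤ ∫⁻ ω, (∫⁻ y, edist x₀ y ∂P x₀ + k * edist x₀ (Z n ω)) ∂Pr :=
          lintegral_mono fun ω ↦ lintegral_edist_kernel_le hk _ _
      _ = ∫⁻ y, edist x₀ y ∂P x₀ + k * ∫⁻ ω, edist x₀ (Z n ω) ∂Pr := by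
          rw [lintegral_add_left measurable_const, lintegral_const, measure_univ, mul_one,
            lintegral_const_mul _ (by have := hZ.measurable n; fun_prop)]
      _ < ∞ := ENNReal.add_lt_top.2
          ⟨(hP x₀).lintegral_edist_lt_top x₀, ENNReal.mul_lt_top (by simp) ih⟩

lemma IsMarkovChain.integrable_sepLipschitz [BorelSpace X] [SecondCountableTopology X]
    {k : ℝ≥0}
    (hk : ∀ x y, W₁ (P x) (P y) ≤ k * edist x y) (hP : ∀ x, MemP₁ (P x)) (hγ₀ : MemP₁ γ₀)
    (hZ : IsMarkovChain Pr Z γ₀ P) {n : ℕ} {ℓ : ℕ → ℝ≥0} {c : ℝ≥0} {G : (Fin (n + 1) → X) → ℝ}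
    (hG : SepLipschitz ℓ c G) :
    Integrable (fun ω ↦ G fun i : Fin (n + 1) ↦ Z i ω) Pr := by
  obtain ⟨x₀⟩ : Nonempty X := hγ₀.2.nonempty
  have hd : ∀ i, Integrable (fun ω ↦ dist (Z i ω) x₀) Pr := fun i ↦ by
    have := hZ.measurable i
    refine ⟨(by fun_prop : Measurable fun ω ↦ dist (Z i ω) x₀).aestronglyMeasurable, ?_⟩
    rw [hasFiniteIntegral_iff_enorm]
    convert hZ.lintegral_edist_lt_top hk hP hγ₀ x₀ i using 3 with ω
    rw [edist_comm, edist_dist, Real.enorm_of_nonneg dist_nonneg]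
  have hm : Measurable fun ω ↦ (fun i : Fin (n + 1) ↦ Z i ω) :=
    measurable_pi_lambda _ fun i ↦ hZ.measurable i
  refine (((integrable_finsetSum Finset.univ fun (i : Fin n) _ ↦ (hd i).const_mul (ℓ i)).add
    ((hd n).const_mul c)).add (integrable_const |G fun _ ↦ x₀|)).mono'
    (hG.lipschitzWith.continuous.measurable.comp hm).aestronglyMeasurable (ae_of_all _ fun ω ↦ ?_)
  have h1 := hG.abs_sub_le (fun i : Fin (n + 1) ↦ Z i ω) fun _ ↦ x₀
  have h2 := abs_sub_abs_le_abs_sub (G fun i : Fin (n + 1) ↦ Z i ω) (G fun _ ↦ x₀)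
  simp only [Fin.val_castSucc, Fin.val_last] at h1
  simp only [Real.norm_eq_abs, Pi.add_apply]
  linarith

/-- The Laplace transform of a Lipschitz function of the path of a chain. The variables are
integrated out one by one, the last one first, each at the cost of a factor `exp (C (L i)² / 2)`
by `T₁(C)`. -/
lemma IsMarkovChain.lintegral_exp_le [BorelSpace X] [SecondCountableTopology X]
    {k : ℝ≥0}
    (hk : ∀ x y, W₁ (P x) (P y) ≤ k * edist x y) {C : ℝ} (hC : 0 ≤ C)
    (hP : ∀ x, SatisfiesT₁ C (P x)) (hγ₀ : SatisfiesT₁ C γ₀)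
    (hZ : IsMarkovChain Pr Z γ₀ P) {ℓ L : ℕ → ℝ≥0} (n : ℕ)
    (hL : ∀ i < n, ℓ i + k * L (i + 1) ≤ L i) {G : (Fin (n + 1) → X) → ℝ}
    (hG : SepLipschitz ℓ (L n) G) :
    ∫⁻ ω, ENNReal.ofReal (Real.exp (G fun i : Fin (n + 1) ↦ Z i ω)) ∂Pr ≤
      ENNReal.ofReal (Real.exp (∫ ω, G (fun i : Fin (n + 1) ↦ Z i ω) ∂Pr +
        C / 2 * ∑ i ∈ Finset.range (n + 1), (L i : ℝ) ^ 2)) := by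
  have hexp : Measurable fun s : ℝ ↦ ENNReal.ofReal (Real.exp s) := by fun_prop
  induction n with
  | zero =>
    have hf : LipschitzWith (L 0) fun u : X ↦ G fun _ ↦ u :=
      LipschitzWith.of_dist_le_mul fun u v ↦ by
        simpa [Real.dist_eq] using hG.abs_sub_le (fun _ ↦ u) fun _ ↦ v
    have h := hγ₀.lintegral_exp_le hC hf
    have hm := hf.continuous.measurable
    rw [← hZ.map_zero, lintegral_map hm.exp.ennreal_ofReal (hZ.measurable 0),
      integral_map (hZ.measurable 0).aemeasurable hm.aestronglyMeasurable] at h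
    have h0 : ∀ ω, (fun i : Fin (0 + 1) ↦ Z i ω) = fun _ ↦ Z 0 ω := fun ω ↦ by
      ext i; simp [Fin.fin_one_eq_zero i]
    simpa [h0] using h
  | succ n ih =>
    have hP₁ := fun x ↦ (hP x).1
    have hG' := hG.integral_snoc hk hP₁ (hL n n.lt_succ_self)
    have ih := ih (fun i hi ↦ hL i (hi.trans n.lt_succ_self)) hG'
    have hcont : Continuous fun z : (Fin (n + 1) → X) × X ↦
        G (Fin.snoc z.1 z.2 : Fin (n + 2) → X) :=
      hG.lipschitzWith.continuous.comp
        (Continuous.finSnoc (A := fun _ ↦ X) continuous_fst continuous_snd)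
    have hsnoc : ∀ ω, (Fin.snoc (fun i : Fin (n + 1) ↦ Z i ω) (Z (n + 1) ω) : Fin (n + 2) → X) =
        fun i : Fin (n + 2) ↦ Z i ω := fun ω ↦ by
      ext i
      refine Fin.lastCases ?_ (fun j ↦ ?_) i <;> simp
    have hmean := hZ.integral_succ n hcont.measurable (by
      simpa only [hsnoc] using hZ.integrable_sepLipschitz hk hP₁ hγ₀.1 hG)
    have hlint := hZ.lintegral_succ n (hexp.comp hcont.measurable)
    simp only [hsnoc, Function.comp_apply] at hmean hlint
    rw [hlint, hmean]
    simp only [Fin.val_last] at ih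
    set S := ∑ i ∈ Finset.range (n + 1), (L i : ℝ) ^ 2
    calc ∫⁻ ω, ∫⁻ u, ENNReal.ofReal (Real.exp
            (G (Fin.snoc (fun i : Fin (n + 1) ↦ Z i ω) u : Fin (n + 2) → X))) ∂P (Z n ω) ∂Pr
        ≤ ∫⁻ ω, ENNReal.ofReal (Real.exp
            (∫ u, G (Fin.snoc (fun i : Fin (n + 1) ↦ Z i ω) u : Fin (n + 2) → X) ∂P (Z n ω))) *
            ENNReal.ofReal (Real.exp (C / 2 * L (n + 1) ^ 2)) ∂Pr := by
          refine lintegral_mono fun ω ↦ ?_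
          rw [← ENNReal.ofReal_mul (Real.exp_pos _).le, ← Real.exp_add]
          exact (hP (Z n ω)).lintegral_exp_le hC (hG.comp_snoc _)
      _ ≤ _ := by
          rw [lintegral_mul_const' _ _ ENNReal.ofReal_ne_top, Finset.sum_range_succ, mul_add,
            ← add_assoc, Real.exp_add _ (C / 2 * (L (n + 1) : ℝ) ^ 2),
            ENNReal.ofReal_mul (Real.exp_pos _).le]
          gcongr

end Chain

end Path

/-! ### Concentration of the empirical measure -/

section Concentration

variable {X : Type*} [MetricSpace X] [MeasurableSpace X]

/-- As `empiricalMeasure` takes a sequence indexed by `ℕ`, the finite path `x` is extended by the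
reduction of the index modulo `m + 2`; only the indices `1, …, m + 1` matter, which is why the
constant of the variable `0` vanishes. -/
lemma sepLipschitz_W₁_empiricalMeasure [PolishSpace X] [BorelSpace X] {μ : Measure X}
    (hμ : MemP₁ μ) (m : ℕ) {c a : ℝ≥0} (hc : c = a * (m + 1 : ℝ≥0)⁻¹) :
    SepLipschitz (fun i ↦ if i = 0 then 0 else c) c fun x : Fin (m + 1 + 1) → X ↦
      a * (W₁ μ (empiricalMeasure (fun (i : ℕ) (x : Fin (m + 1 + 1) → X) ↦
        x (Fin.ofNat (m + 1 + 1) i)) (m + 1) x)).toReal := by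
  have := hμ.1
  intro x y
  set Y : ℕ → (Fin (m + 1 + 1) → X) → X := fun i x ↦ x (Fin.ofNat (m + 1 + 1) i)
  have hY : ∀ (i : Fin (m + 1 + 1)) (x : Fin (m + 1 + 1) → X), Y i x = x i := fun i x ↦ by simp [Y]
  have hsum : ∑ i : Fin (m + 1), ((if (i : ℕ) = 0 then 0 else c : ℝ≥0) : ℝ) *
      dist (x i.castSucc) (y i.castSucc) +
      c * dist (x (Fin.last (m + 1))) (y (Fin.last (m + 1))) =
      c * ∑ i ∈ Finset.Icc 1 (m + 1), dist (Y i x) (Y i y) := by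
    have h1 := Fin.sum_univ_castSucc fun i : Fin (m + 1 + 1) ↦
      ((if (i : ℕ) = 0 then 0 else c : ℝ≥0) : ℝ) * dist (Y i x) (Y i y)
    rw [← Finset.sum_range fun i ↦
      ((if i = 0 then 0 else c : ℝ≥0) : ℝ) * dist (Y i x) (Y i y)] at h1
    simp only [hY] at h1
    simp only [Fin.val_castSucc, Fin.val_last, Nat.add_eq_zero_iff, one_ne_zero, and_false,
      if_false] at h1
    rw [← h1, Finset.range_eq_Ico, Finset.sum_eq_sum_Ico_succ_bot (by lia), Finset.mul_sum]
    simp only [if_true, NNReal.coe_zero, zero_mul, zero_add]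
    refine Finset.sum_congr (by ext; simp) fun i hi ↦ ?_
    rw [if_neg (by have := Finset.mem_Icc.1 hi; lia)]
  have hle : (W₁ μ (empiricalMeasure Y (m + 1) x)).toReal ≤
      (W₁ μ (empiricalMeasure Y (m + 1) y)).toReal +
        (m + 1 : ℝ)⁻¹ * ∑ i ∈ Finset.Icc 1 (m + 1), dist (Y i x) (Y i y) := by
    have hne := W₁_empiricalMeasure_ne_top hμ Y (Nat.succ_pos m) y
    have hne' : ((m + 1 : ℕ) : ℝ≥0∞)⁻¹ * ∑ i ∈ Finset.Icc 1 (m + 1), edist (Y i y) (Y i x) ≠ ∞ :=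
      ENNReal.mul_ne_top (by simp) (ENNReal.sum_ne_top.2 fun i _ ↦ edist_ne_top _ _)
    have h := ENNReal.toReal_mono (ENNReal.add_ne_top.2 ⟨hne, hne'⟩)
      (W₁_empiricalMeasure_le_add (μ := μ) Y (n := m + 1) y x)
    rw [ENNReal.toReal_add hne hne', ENNReal.toReal_mul,
      ENNReal.toReal_sum fun i _ ↦ edist_ne_top _ _, ENNReal.toReal_inv,
      ENNReal.toReal_natCast] at h
    simp_rw [edist_dist, ENNReal.toReal_ofReal dist_nonneg, dist_comm (Y _ y)] at h
    exact_mod_cast h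
  have hc' : (c : ℝ) = a * (m + 1 : ℝ)⁻¹ := by rw [hc]; push_cast; rfl
  refine le_of_le_of_eq ?_ hsum.symm
  rw [hc', mul_assoc, ← mul_sub]
  gcongr
  linarith

/-- The choice of constants. With `r = 1 - k`, a function which is `r s`-Lipschitz in each of the
variables `1, …, n` and does not depend on the variable `0` has effective constants `L 0 = k s`,
`L i = s` for `0 < i < n`, and `L n = r s`. As `k² + r² ≤ 1`, the variable `0` does not add to
the bound `n s²` for the sum of their squares. -/
lemma IsMarkovChain.lintegral_exp_le_of_forall_eq [BorelSpace X] [SecondCountableTopology X]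
    {Ω : Type*} [MeasurableSpace Ω] {Pr : Measure Ω} [IsProbabilityMeasure Pr] {Z : ℕ → Ω → X}
    {γ₀ : Measure X} {P : Kernel X X} [IsMarkovKernel P] {k r : ℝ≥0} (hkr : r + k = 1)
    (hk : ∀ x y, W₁ (P x) (P y) ≤ k * edist x y) {C : ℝ} (hC : 0 ≤ C)
    (hP : ∀ x, SatisfiesT₁ C (P x)) (hγ₀ : SatisfiesT₁ C γ₀)
    (hZ : IsMarkovChain Pr Z γ₀ P) (m : ℕ) (s : ℝ≥0) {G : (Fin (m + 1 + 1) → X) → ℝ}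
    (hG : SepLipschitz (fun i ↦ if i = 0 then 0 else r * s) (r * s) G) :
    ∫⁻ ω, ENNReal.ofReal (Real.exp (G fun i : Fin (m + 1 + 1) ↦ Z i ω)) ∂Pr ≤
      ENNReal.ofReal (Real.exp (∫ ω, G (fun i : Fin (m + 1 + 1) ↦ Z i ω) ∂Pr +
        C / 2 * ((m + 1) * s ^ 2))) := by
  let L : ℕ → ℝ≥0 := fun i ↦ if i = 0 then k * s else if i = m + 1 then r * s else s
  have hk1 : k ≤ 1 := hkr ▸ le_add_self
  have hr1 : r ≤ 1 := hkr ▸ le_self_add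
  have hLs : ∀ i, L i ≤ s := fun i ↦ by
    simp only [L]
    split_ifs
    exacts [mul_le_of_le_one_left' hk1, mul_le_of_le_one_left' hr1, le_rfl]
  have hLm : L (m + 1) = r * s := by simp [L]
  have hL : ∀ i < m + 1, (if i = 0 then 0 else r * s) + k * L (i + 1) ≤ L i := by
    intro i hi
    rcases Nat.eq_zero_or_pos i with rfl | hi0
    · simpa [L] using mul_le_mul_right (hLs 1) k
    · have hLi : L i = s := by simp [L, hi0.ne', hi.ne]
      rw [if_neg hi0.ne', hLi]
      calc r * s + k * L (i + 1) ≤ r * s + k * s := by gcongr; exact hLs _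
        _ = s := by rw [← add_mul, hkr, one_mul]
  refine (hZ.lintegral_exp_le hk hC hP hγ₀ (m + 1) hL (hLm.symm ▸ hG)).trans ?_
  gcongr
  have hkr' : (r : ℝ) + k = 1 := by exact_mod_cast hkr
  have hsum : ∑ i ∈ Finset.range (m + 1), (L i : ℝ) ^ 2 ≤ (k * s) ^ 2 + m * (s : ℝ) ^ 2 := by
    rw [Finset.sum_range_succ', add_comm]
    gcongr
    · simp [L]
    · refine (Finset.sum_le_card_nsmul _ _ ((s : ℝ) ^ 2) fun i _ ↦ ?_).trans_eq (by simp)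
      gcongr
      exact hLs _
  rw [Finset.sum_range_succ, hLm, NNReal.coe_mul]
  have : 0 ≤ r * k * (s : ℝ) ^ 2 := by positivity
  have hr : (r : ℝ) = 1 - k := by linarith
  rw [hr] at this ⊢
  nlinarith

end Concentration

end MarkovConc

theorem theorem3 {X : Type*} [MetricSpace X] [PolishSpace X] [MeasurableSpace X] [BorelSpace X]
    (P : Kernel X X) [IsMarkovKernel P] (κ : ℝ) (hP : MarkovConc.IsExpContracting P 1 κ)
    (μ : Measure X) [IsProbabilityMeasure μ] (hμ : Kernel.Invariant P μ)
    (γ₀ : Measure X) (C : ℝ) (hC : 0 < C)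
    (hγ₀ : MarkovConc.SatisfiesT₁ C γ₀) (hPT : ∀ x, MarkovConc.SatisfiesT₁ C (P x))
    {Ω : Type*} [MeasurableSpace Ω] (Pr : Measure Ω) [IsProbabilityMeasure Pr]
    (Z : ℕ → Ω → X) (hZ : MarkovConc.IsMarkovChain Pr Z γ₀ P) (n : ℕ) (hn : 1 ≤ n) :
    (∀ ω, MarkovConc.W₁ μ (MarkovConc.empiricalMeasure Z n ω) ≠ ∞) ∧
    Integrable (fun ω ↦ (MarkovConc.W₁ μ (MarkovConc.empiricalMeasure Z n ω)).toReal) Pr ∧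
    ∀ t : ℝ, 0 ≤ t →
      Pr.real {ω | (∫ ω', (MarkovConc.W₁ μ (MarkovConc.empiricalMeasure Z n ω')).toReal ∂Pr) + t
          ≤ (MarkovConc.W₁ μ (MarkovConc.empiricalMeasure Z n ω)).toReal} ≤
        Real.exp (-(1 / (2 * C)) * n * t ^ 2 * (1 - κ) ^ 2) := by
  obtain ⟨m, rfl⟩ : ∃ m, n = m + 1 := ⟨n - 1, by lia⟩
  have hκ0 := hP.pos
  have hκ1 := hP.lt_one
  have hk : ∀ x y, MarkovConc.W₁ (P x) (P y) ≤ (κ.toNNReal : ℝ≥0∞) * edist x y := fun x y ↦ by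
    simpa [ENNReal.ofReal] using hP.contracting 1 le_rfl x y
  have hP₁ := fun x ↦ (hPT x).1
  have hμ₁ : MarkovConc.MemP₁ μ :=
    MarkovConc.memP₁_of_invariant (Real.toNNReal_lt_one.2 hκ1) hk hP₁ hμ
  let F : (Fin (m + 1 + 1) → X) → ℝ := fun x ↦
    (MarkovConc.W₁ μ (MarkovConc.empiricalMeasure (fun (i : ℕ) (x : Fin (m + 1 + 1) → X) ↦
      x (Fin.ofNat (m + 1 + 1) i)) (m + 1) x)).toReal
  have hF : ∀ ω, (MarkovConc.W₁ μ (MarkovConc.empiricalMeasure Z (m + 1) ω)).toReal =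
      F fun i : Fin (m + 1 + 1) ↦ Z i ω := by
    intro ω
    simp only [F, MarkovConc.empiricalMeasure]
    congr 3
    refine Finset.sum_congr rfl fun i hi ↦ ?_
    rw [Fin.val_ofNat, Nat.mod_eq_of_lt (by have := Finset.mem_Icc.1 hi; lia)]
  have hint : Integrable (fun ω ↦ F fun i : Fin (m + 1 + 1) ↦ Z i ω) Pr := by
    have h := hZ.integrable_sepLipschitz hk hP₁ hγ₀.1
      (MarkovConc.sepLipschitz_W₁_empiricalMeasure hμ₁ m (a := 1) rfl)
    simp_rw [NNReal.coe_one, one_mul] at h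
    exact h
  refine ⟨fun ω ↦ MarkovConc.W₁_empiricalMeasure_ne_top hμ₁ Z hn ω, by simpa only [hF] using hint,
    fun t ht ↦ ?_⟩
  simp_rw [hF]
  set M := ∫ ω, F (fun i : Fin (m + 1 + 1) ↦ Z i ω) ∂Pr
  have hr : 0 < 1 - κ := sub_pos.2 hκ1
  have hm : (0 : ℝ) < m + 1 := by positivity
  -- the minimizer of the exponent `-lam t + C lam² / (2 n (1 - κ)²)`
  set lam : ℝ := t * (m + 1) * (1 - κ) ^ 2 / C with hlam
  have hlam0 : 0 ≤ lam := by positivity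
  have hs : ((lam / ((m + 1) * (1 - κ))).toNNReal : ℝ) = lam / ((m + 1) * (1 - κ)) :=
    Real.coe_toNNReal _ (by positivity)
  have hG := MarkovConc.sepLipschitz_W₁_empiricalMeasure hμ₁ m (a := lam.toNNReal)
    (c := (1 - κ).toNNReal * (lam / ((m + 1) * (1 - κ))).toNNReal) (NNReal.eq (by
      push_cast
      rw [hs, Real.coe_toNNReal _ hr.le, Real.coe_toNNReal _ hlam0]
      field_simp))
  have hexp := hZ.lintegral_exp_le_of_forall_eq (r := (1 - κ).toNNReal) (k := κ.toNNReal)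
    (by rw [← Real.toNNReal_add hr.le hκ0.le]; simp) hk hC.le hPT hγ₀ m _ hG
  rw [Real.coe_toNNReal _ hlam0, hs] at hexp
  change ∫⁻ ω, ENNReal.ofReal (Real.exp (lam * F fun i : Fin (m + 1 + 1) ↦ Z i ω)) ∂Pr ≤
    ENNReal.ofReal (Real.exp (∫ ω, lam * F (fun i : Fin (m + 1 + 1) ↦ Z i ω) ∂Pr +
      C / 2 * ((m + 1) * (lam / ((m + 1) * (1 - κ))) ^ 2))) at hexp
  rw [integral_const_mul] at hexp
  have hexp_int : Integrable (fun ω ↦ Real.exp (lam * F fun i : Fin (m + 1 + 1) ↦ Z i ω)) Pr :=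
    (lintegral_ofReal_ne_top_iff_integrable
      (Real.continuous_exp.comp_aestronglyMeasurable (hint.const_mul lam).aestronglyMeasurable)
      (ae_of_all _ fun _ ↦ (Real.exp_pos _).le)).1 (hexp.trans_lt ENNReal.ofReal_lt_top).ne
  rw [← ofReal_integral_eq_lintegral_ofReal hexp_int (ae_of_all _ fun _ ↦ (Real.exp_pos _).le),
    ENNReal.ofReal_le_ofReal_iff (Real.exp_pos _).le] at hexp
  calc Pr.real {ω | M + t ≤ F fun i : Fin (m + 1 + 1) ↦ Z i ω}
      ≤ Real.exp (-lam * (M + t)) * ∫ ω, Real.exp (lam * F fun i : Fin (m + 1 + 1) ↦ Z i ω) ∂Pr :=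
        measure_ge_le_exp_mul_mgf _ hlam0 hexp_int
    _ ≤ Real.exp (-lam * (M + t)) *
          Real.exp (lam * M + C / 2 * ((m + 1) * (lam / ((m + 1) * (1 - κ))) ^ 2)) := by gcongr
    _ = Real.exp (-(1 / (2 * C)) * (m + 1 : ℕ) * t ^ 2 * (1 - κ) ^ 2) := by
        rw [← Real.exp_add, hlam]
        congr 1
        push_cast
        field_simp
        ring
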